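/- **Pandora's box with sequential inspection.** There are finitely many boxes. Box $i$ has a type $T_i$ with a discrete distribution and a real integrable prize $V_i$ (integrable also conditionally on each type); the pairs $(V_i,T_i)$ have known joint laws and are independent across boxes. Opening costs $c_i^F>0$ and $c_i^P>0$ are given. A state is $(\mathcal C,\mathcal P,y)$, where $\mathcal C$ is the set of closed boxes, $\mathcal P$ is the set of pairs $(i,t_i)$ of partially opened boxes with their revealed types, and $y\in\mathbb R$ is the best prize at hand. The possible actions are: stop and collect $y$; F-open a box $i$ that is closed or partially opened, which costs $c_i^F$, reveals $V_i$, removes box $i$ and replaces $y$ by $\max\{y,V_i\}$; P-open a closed box $i$, which costs $c_i^P$, reveals $T_i$ and moves box $i$ to $\mathcal P$. A policy from a state on is an adaptive rule (decision tree) that chooses actions on the basis of what has been observed, with a measurable profit-to-go; it is optimal in that state if no other policy has a larger expected profit from that state on. The thresholds $\sigma_i^F,\ \sigma_i^{F\mid t},\ \sigma_i^P\in\mathbb R$ are the unique solutions of $$c_i^F=\mathbb E[(V_i-\sigma_i^F)^+],\qquad c_i^F=\mathbb E[(V_i-\sigma_i^{F\mid t})^+\mid T_i=t],\qquad c_i^P=\mathbb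 E\big[\max\{0,\,-c_i^F+\mathbb E[(V_i-\sigma_i^P)^+\mid T_i]\}\big].$$ The opening thresholds of a state are $\sigma_i^F,\sigma_i^P$ for $i\in\mathcal C$ and $\sigma_i^{F\mid t_i}$ for $(i,t_i)\in\mathcal P$. "Largest" means at least as large as every opening threshold of the state (ties are allowed). **Theorem.** Let $(\mathcal C,\mathcal P,y)$ be any state. 1. If stopping is not optimal and $\sigma_k^{F\mid t_k}$, for some $(k,t_k)\in\mathcal P$, is the largest opening threshold, then some optimal policy immediately F-opens box $k$. 2. If stopping is not optimal and $\sigma_i^F$, for some $i\in\mathcal C$ with $\sigma_i^F>\sigma_i^P$, is the largest opening threshold, then some optimal policy immediately F-opens box $i$. 3. If $\sigma_i^F$, for some $i\in\mathcal C$ with $\sigma_i^F>\sigma_i^P$, is the largest opening threshold (whether or not stopping is optimal), then P-opening box $i$ is dominated: for every policy that starts by P-opening box $i$, either stopping immediately or some policy that starts by F-opening box $i$ has at least as large an expected profit. -/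

import Mathlib

open MeasureTheory Filter Topology

noncomputable section

namespace Pandora

/-! ### Boxes -/

/-- A box. The type is drawn from the discrete distribution `typeDist`, and, given that the type
is `t`, the prize is drawn from `prizeDist t`; together they are the joint law of (prize, type).
`fCost` and `pCost` are the costs of F-opening (full opening) and P-opening (partial opening). -/
structure Box (Γ : Type*) where
  typeDist : PMF Γ
  prizeDist : Γ → Measure ℝ
  isProbabilityMeasure_prizeDist : ∀ t, IsProbabilityMeasure (prizeDist t)
  integrable_prizeDist : ∀ t, Integrable (fun v : ℝ => v) (prizeDist t)
  integrable_sum : Integrable (fun v : ℝ => v) (Measure.sum fun t => typeDist t • prizeDist t)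
  fCost : ℝ
  pCost : ℝ
  fCost_pos : 0 < fCost
  pCost_pos : 0 < pCost

variable {Γ : Type*}

/-- The unconditional law of the prize. -/
def Box.prizeLaw (b : Box Γ) : Measure ℝ :=
  Measure.sum fun t => b.typeDist t • b.prizeDist t

/-- `E[(V - x)⁺]` when the prize `V` has law `μ`. -/
def excess (μ : Measure ℝ) (x : ℝ) : ℝ := ∫ v, max (v - x) 0 ∂μ

/-- `E[max {0, -c^F + E[(V - x)⁺ | T]}]`. -/
def Box.pExcess (b : Box Γ) (x : ℝ) : ℝ :=
  ∑' t, (b.typeDist t).toReal * max 0 (-b.fCost + excess (b.prizeDist t) x)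

/-! ### The equations that define the thresholds have exactly one solution -/

theorem existsUnique_of_convexOn {h : ℝ → ℝ} (hc : ConvexOn ℝ Set.univ h)
    (htop : Tendsto h atTop (𝓝 0)) (hbot : Tendsto h atBot atTop) {c : ℝ} (c_pos : 0 < c) :
    ∃! x, h x = c := by
  have hcont : Continuous h := by
    rw [← continuousOn_univ]
    exact hc.continuousOn isOpen_univ
  have key : ∀ a b : ℝ, a < b → h a = c → h b = c → False := by
    intro a b hab ha hb
    have hev : ∀ᶠ z in atTop, h z < c := htop.eventually (gt_mem_nhds c_pos)
    obtain ⟨z, hz, hzb⟩ := (hev.and (eventually_gt_atTop b)).exists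
    have := hc.slope_mono_adjacent (Set.mem_univ a) (Set.mem_univ z) hab hzb
    rw [ha, hb, sub_self, zero_div] at this
    have h2 : (h z - c) / (z - b) < 0 := div_neg_of_neg_of_pos (by linarith) (by linarith)
    linarith
  obtain ⟨a, ha⟩ := (hbot.eventually (eventually_ge_atTop c)).exists
  obtain ⟨d, hd⟩ := (htop.eventually (gt_mem_nhds c_pos)).exists
  obtain ⟨x, hx⟩ := mem_range_of_exists_le_of_exists_ge hcont ⟨d, hd.le⟩ ⟨a, ha⟩
  refine ⟨x, hx, fun y hy => ?_⟩
  rcases lt_trichotomy x y with hlt | heq | hgt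
  · exact (key x y hlt hx hy).elim
  · exact heq.symm
  · exact (key y x hgt hy hx).elim

theorem integrable_excess {μ : Measure ℝ} [IsProbabilityMeasure μ]
    (hμ : Integrable (fun v : ℝ => v) μ) (x : ℝ) :
    Integrable (fun v : ℝ => max (v - x) 0) μ :=
  (hμ.sub (integrable_const x)).pos_part

theorem convexOn_excess {μ : Measure ℝ} [IsProbabilityMeasure μ]
    (hμ : Integrable (fun v : ℝ => v) μ) : ConvexOn ℝ Set.univ (excess μ) := by
  refine ⟨convex_univ, fun x _ y _ a b ha hb hab => ?_⟩
  have hx := (integrable_excess hμ x).const_mul a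
  have hy := (integrable_excess hμ y).const_mul b
  simp only [smul_eq_mul, excess]
  rw [← integral_const_mul, ← integral_const_mul, ← integral_add hx hy]
  refine integral_mono (integrable_excess hμ _) (hx.add hy) fun v => ?_
  have h1 : v - (a * x + b * y) = a * (v - x) + b * (v - y) := by
    have : v = (a + b) * v := by rw [hab, one_mul]
    linear_combination this
  have h2 := mul_le_mul_of_nonneg_left (le_max_left (v - x) 0) ha
  have h3 := mul_le_mul_of_nonneg_left (le_max_left (v - y) 0) hb
  have h4 := mul_nonneg ha (le_max_right (v - x) 0)
  have h5 := mul_nonneg hb (le_max_right (v - y) 0)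
  exact max_le (by linarith) (by linarith)

theorem tendsto_excess_atTop {μ : Measure ℝ} [IsProbabilityMeasure μ]
    (hμ : Integrable (fun v : ℝ => v) μ) : Tendsto (excess μ) atTop (𝓝 0) := by
  have h := tendsto_integral_filter_of_dominated_convergence (μ := μ) (l := atTop)
    (F := fun (x : ℝ) (v : ℝ) => max (v - x) 0) (f := fun _ => (0 : ℝ)) (fun v => |v|)
    (Eventually.of_forall fun x => (integrable_excess hμ x).aestronglyMeasurable)
    (by
      filter_upwards [eventually_ge_atTop (0 : ℝ)] with x hx
      refine Eventually.of_forall fun v => ?_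
      rw [Real.norm_eq_abs, abs_of_nonneg (le_max_right _ _)]
      exact max_le (by linarith [le_abs_self v]) (abs_nonneg v))
    hμ.abs
    (Eventually.of_forall fun v => by
      refine tendsto_const_nhds.congr' ?_
      filter_upwards [eventually_ge_atTop v] with x hx
      rw [max_eq_right (by linarith)])
  rw [integral_zero] at h
  exact h

theorem sub_le_excess {μ : Measure ℝ} [IsProbabilityMeasure μ]
    (hμ : Integrable (fun v : ℝ => v) μ) (x : ℝ) : ∫ v, v ∂μ - x ≤ excess μ x := by
  have h : ∫ v, (v - x) ∂μ ≤ excess μ x :=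
    integral_mono (hμ.sub (integrable_const x)) (integrable_excess hμ x) fun v => le_max_left _ _
  rwa [integral_sub hμ (integrable_const x), integral_const, probReal_univ, one_smul] at h

theorem tendsto_excess_atBot {μ : Measure ℝ} [IsProbabilityMeasure μ]
    (hμ : Integrable (fun v : ℝ => v) μ) : Tendsto (excess μ) atBot atTop := by
  refine tendsto_atTop_mono (sub_le_excess hμ) ?_
  exact tendsto_atTop_add_const_left _ _ tendsto_neg_atBot_atTop

theorem excess_nonneg (μ : Measure ℝ) (x : ℝ) : 0 ≤ excess μ x :=
  integral_nonneg fun _ => le_max_right _ _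

theorem existsUnique_excess {μ : Measure ℝ} [IsProbabilityMeasure μ]
    (hμ : Integrable (fun v : ℝ => v) μ) {c : ℝ} (hc : 0 < c) : ∃! x, excess μ x = c :=
  existsUnique_of_convexOn (convexOn_excess hμ) (tendsto_excess_atTop hμ)
    (tendsto_excess_atBot hμ) hc

instance Box.isProbabilityMeasure_prizeLaw (b : Box Γ) : IsProbabilityMeasure b.prizeLaw := by
  have := b.isProbabilityMeasure_prizeDist
  refine ⟨?_⟩
  simp [Box.prizeLaw, b.typeDist.tsum_coe]

theorem Box.hasSum_excess (b : Box Γ) (x : ℝ) :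
    HasSum (fun t => (b.typeDist t).toReal * excess (b.prizeDist t) x) (excess b.prizeLaw x) := by
  have h := hasSum_integral_measure (integrable_excess (μ := b.prizeLaw) b.integrable_sum x)
  simp only [integral_smul_measure, smul_eq_mul] at h
  exact h

theorem Box.hasSum_typeDist (b : Box Γ) : HasSum (fun t => (b.typeDist t).toReal) 1 := by
  have h := ENNReal.hasSum_toReal (f := fun t => b.typeDist t)
    (by rw [b.typeDist.tsum_coe]; exact ENNReal.one_ne_top)
  rwa [← ENNReal.tsum_toReal_eq fun t => b.typeDist.apply_ne_top t, b.typeDist.tsum_coe,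
    ENNReal.toReal_one] at h

theorem Box.pTerm_le (b : Box Γ) (x : ℝ) (t : Γ) :
    (b.typeDist t).toReal * max 0 (-b.fCost + excess (b.prizeDist t) x) ≤
      (b.typeDist t).toReal * excess (b.prizeDist t) x :=
  mul_le_mul_of_nonneg_left
    (max_le (excess_nonneg _ _) (by linarith [b.fCost_pos])) ENNReal.toReal_nonneg

theorem Box.pTerm_nonneg (b : Box Γ) (x : ℝ) (t : Γ) :
    0 ≤ (b.typeDist t).toReal * max 0 (-b.fCost + excess (b.prizeDist t) x) :=
  mul_nonneg ENNReal.toReal_nonneg (le_max_left _ _)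

theorem Box.summable_pTerm (b : Box Γ) (x : ℝ) :
    Summable fun t => (b.typeDist t).toReal * max 0 (-b.fCost + excess (b.prizeDist t) x) :=
  Summable.of_nonneg_of_le (b.pTerm_nonneg x) (b.pTerm_le x) (b.hasSum_excess x).summable

theorem Box.convexOn_pExcess (b : Box Γ) : ConvexOn ℝ Set.univ b.pExcess := by
  refine ⟨convex_univ, fun x _ y _ p q hp hq hpq => ?_⟩
  simp only [smul_eq_mul, Box.pExcess]
  rw [← tsum_mul_left, ← tsum_mul_left,
    ← ((b.summable_pTerm x).mul_left p).tsum_add ((b.summable_pTerm y).mul_left q)]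
  refine (b.summable_pTerm _).tsum_le_tsum (fun t => ?_)
    (((b.summable_pTerm x).mul_left p).add ((b.summable_pTerm y).mul_left q))
  have := b.isProbabilityMeasure_prizeDist t
  have hconv := (convexOn_excess (b.integrable_prizeDist t)).2
    (Set.mem_univ x) (Set.mem_univ y) hp hq hpq
  simp only [smul_eq_mul] at hconv
  have h1 := mul_le_mul_of_nonneg_left
    (le_max_right 0 (-b.fCost + excess (b.prizeDist t) x)) hp
  have h2 := mul_le_mul_of_nonneg_left
    (le_max_right 0 (-b.fCost + excess (b.prizeDist t) y)) hq
  have h3 := mul_nonneg hp (le_max_left 0 (-b.fCost + excess (b.prizeDist t) x))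
  have h4 := mul_nonneg hq (le_max_left 0 (-b.fCost + excess (b.prizeDist t) y))
  have h5 : b.fCost = p * b.fCost + q * b.fCost := by rw [← add_mul, hpq, one_mul]
  have h6 : max 0 (-b.fCost + excess (b.prizeDist t) (p * x + q * y)) ≤
      p * max 0 (-b.fCost + excess (b.prizeDist t) x) +
        q * max 0 (-b.fCost + excess (b.prizeDist t) y) :=
    max_le (by linarith) (by linarith)
  have h7 := mul_le_mul_of_nonneg_left h6 (ENNReal.toReal_nonneg (a := b.typeDist t))
  linarith

theorem Box.tendsto_pExcess_atTop (b : Box Γ) : Tendsto b.pExcess atTop (𝓝 0) := by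
  refine squeeze_zero (fun x => tsum_nonneg (b.pTerm_nonneg x)) (fun x => ?_)
    (tendsto_excess_atTop (μ := b.prizeLaw) b.integrable_sum)
  rw [← (b.hasSum_excess x).tsum_eq]
  exact (b.summable_pTerm x).tsum_le_tsum (b.pTerm_le x) (b.hasSum_excess x).summable

theorem Box.tendsto_pExcess_atBot (b : Box Γ) : Tendsto b.pExcess atBot atTop := by
  refine tendsto_atTop_mono (f := fun x => -b.fCost + excess b.prizeLaw x) (fun x => ?_)
    (tendsto_atTop_add_const_left _ _ (tendsto_excess_atBot (μ := b.prizeLaw) b.integrable_sum))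
  have h := (b.hasSum_typeDist.mul_right (-b.fCost)).add (b.hasSum_excess x)
  rw [one_mul] at h
  rw [← h.tsum_eq]
  refine h.summable.tsum_le_tsum (fun t => ?_) (b.summable_pTerm x)
  rw [← mul_add]
  exact mul_le_mul_of_nonneg_left (le_max_right _ _) ENNReal.toReal_nonneg

theorem Box.existsUnique_fThreshold (b : Box Γ) : ∃! x, excess b.prizeLaw x = b.fCost :=
  existsUnique_excess (μ := b.prizeLaw) b.integrable_sum b.fCost_pos

theorem Box.existsUnique_condThreshold (b : Box Γ) (t : Γ) :
    ∃! x, excess (b.prizeDist t) x = b.fCost :=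
  have := b.isProbabilityMeasure_prizeDist t
  existsUnique_excess (b.integrable_prizeDist t) b.fCost_pos

theorem Box.existsUnique_pThreshold (b : Box Γ) : ∃! x, b.pExcess x = b.pCost :=
  existsUnique_of_convexOn b.convexOn_pExcess b.tendsto_pExcess_atTop b.tendsto_pExcess_atBot
    b.pCost_pos

/-! ### Thresholds -/

/-- The F-threshold `σ^F` of a closed box: the solution of `c^F = E[(V - σ)⁺]`. -/
def Box.fThreshold (b : Box Γ) : ℝ := b.existsUnique_fThreshold.choose

/-- The conditional F-threshold `σ^{F|t}` of a partially opened box whose type was found to be `t`: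
the solution of `c^F = E[(V - σ)⁺ | T = t]`. -/
def Box.condThreshold (b : Box Γ) (t : Γ) : ℝ := (b.existsUnique_condThreshold t).choose

/-- The P-threshold `σ^P` of a closed box:
the solution of `c^P = E[max {0, -c^F + E[(V - σ)⁺ | T]}]`. -/
def Box.pThreshold (b : Box Γ) : ℝ := b.existsUnique_pThreshold.choose

theorem Box.fThreshold_eq_iff (b : Box Γ) (x : ℝ) :
    b.fThreshold = x ↔ excess b.prizeLaw x = b.fCost :=
  ⟨fun h => h ▸ b.existsUnique_fThreshold.choose_spec.1,
    fun h => (b.existsUnique_fThreshold.choose_spec.2 x h).symm⟩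

theorem Box.condThreshold_eq_iff (b : Box Γ) (t : Γ) (x : ℝ) :
    b.condThreshold t = x ↔ excess (b.prizeDist t) x = b.fCost :=
  ⟨fun h => h ▸ (b.existsUnique_condThreshold t).choose_spec.1,
    fun h => ((b.existsUnique_condThreshold t).choose_spec.2 x h).symm⟩

theorem Box.pThreshold_eq_iff (b : Box Γ) (x : ℝ) :
    b.pThreshold = x ↔ b.pExcess x = b.pCost :=
  ⟨fun h => h ▸ b.existsUnique_pThreshold.choose_spec.1,
    fun h => (b.existsUnique_pThreshold.choose_spec.2 x h).symm⟩

/-! ### States -/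

/-- The status of a box: closed, partially opened with revealed type `t`, or no longer available
(it was F-opened). -/
inductive Status (Γ : Type*) where
  | closed : Status Γ
  | partly (t : Γ) : Status Γ
  | gone : Status Γ

/-- A state `(C, P, y)`: `C` is the set of boxes with status `closed`, `P` is the set of pairs
`(i, t)` such that box `i` has status `partly t`, and `y = best` is the best prize at hand. -/
structure State {ι : Type*} (Γ : ι → Type*) where
  status : ∀ i, Status (Γ i)
  best : ℝ

/-- The law of the prize of a box, given what its status reveals (irrelevant for `gone`). -/
def Box.lawGiven (b : Box Γ) : Status Γ → Measure ℝ
  | .closed => b.prizeLaw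
  | .partly t => b.prizeDist t
  | .gone => 0

variable {ι : Type*} [DecidableEq ι] {Γ : ι → Type*}

/-- The state that follows when box `i` is F-opened and its prize turns out to be `v`. -/
def State.afterF (s : State Γ) (i : ι) (v : ℝ) : State Γ where
  status := Function.update s.status i .gone
  best := max s.best v

/-- The state that follows when box `i` is P-opened and its type turns out to be `t`. -/
def State.afterP (s : State Γ) (i : ι) (t : Γ i) : State Γ where
  status := Function.update s.status i (.partly t)
  best := s.best

/-- The opening thresholds available in a state: the F- and P-thresholds of its closed boxes and
the conditional F-thresholds of its partially opened boxes. -/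
def openingThresholds {ι : Type*} {Γ : ι → Type*} (box : ∀ i, Box (Γ i)) (s : State Γ) : Set ℝ :=
  {x | (∃ i, s.status i = .closed ∧ (x = (box i).fThreshold ∨ x = (box i).pThreshold)) ∨
    ∃ i t, s.status i = .partly t ∧ x = (box i).condThreshold t}

/-! ### Policies -/

/-- A (history-dependent) policy from a given state on, as a decision tree: stop and collect the
best prize at hand, F-open box `i` and continue according to the observed prize, or P-open box `i`
and continue according to the observed type. -/
inductive Policy {ι : Type*} (Γ : ι → Type*) where
  | halt : Policy Γ
  | fOpen (i : ι) (next : ℝ → Policy Γ) : Policy Γ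
  | pOpen (i : ι) (next : Γ i → Policy Γ) : Policy Γ

/-- The expected profit of a policy started in state `s`. -/
def Policy.profit (box : ∀ i, Box (Γ i)) : Policy Γ → State Γ → ℝ
  | .halt, s => s.best
  | .fOpen i next, s =>
      -(box i).fCost + ∫ v, (next v).profit box (s.afterF i v) ∂(box i).lawGiven (s.status i)
  | .pOpen i next, s =>
      -(box i).pCost + ∑' t, ((box i).typeDist t).toReal * (next t).profit box (s.afterP i t)

/-- A policy is admissible in state `s` if it F-opens only closed or partially opened boxes,
P-opens only closed boxes, and the profit to go is a measurable function of each observed prize. -/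
def Policy.Admissible (box : ∀ i, Box (Γ i)) : Policy Γ → State Γ → Prop
  | .halt, _ => True
  | .fOpen i next, s =>
      s.status i ≠ .gone ∧ (∀ v, (next v).Admissible box (s.afterF i v)) ∧
        AEMeasurable (fun v => (next v).profit box (s.afterF i v))
          ((box i).lawGiven (s.status i))
  | .pOpen i next, s =>
      s.status i = .closed ∧ ∀ t, (next t).Admissible box (s.afterP i t)

/-- A policy is optimal in state `s` if it is admissible there and no admissible policy has a
larger expected profit. -/
def Policy.IsOptimal (box : ∀ i, Box (Γ i)) (π : Policy Γ) (s : State Γ) : Prop :=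
  π.Admissible box s ∧ ∀ π' : Policy Γ, π'.Admissible box s → π'.profit box s ≤ π.profit box s

end Pandora

end

/-!
The proof compares states through the value function `Pandora.value`, the supremum of the expected
profits of the admissible policies. By induction on the statuses (`Pandora.isRegular`) it is
attained and monotone in the best prize at hand, hence measurable in the observed prizes, and it
satisfies Bellman's inequality (`Pandora.value_le_of_actions`).

The key is a relaxation. If `σ` is at least every opening threshold of a state, then its value is
at most the expected value of the state in which the prize of some available box `i` is revealed at
no cost, but truncated at `σ` (`Pandora.CappedBound`, proved in
`Pandora.cappedBound_and_stopsAboveThresholds`). By induction it suffices to bound each first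
action:

* F-opening box `i` gains its expected excess over `σ`, which is at most the cost;
* P-opening box `i` gains at most `pExcess σ`, which is at most the cost because `σ` is at least
  the P-threshold;
* opening another box commutes with revealing the free prize, by Fubini's theorem. The induction
  hypothesis for level `σ` fails only when P-opening box `j` reveals a type with conditional
  threshold above `σ`; the bound at that threshold then says that F-opening box `j` at once is
  optimal, and this F-opening again commutes with the free prize.

With `σ` the best prize at hand, the relaxation shows that stopping is optimal once no threshold
exceeds that prize. With `σ` the largest threshold, an F-threshold or conditional F-threshold of
box `i`, the expected excess over `σ` equals the cost, so the relaxed value is exactly the profit of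
F-opening box `i` and continuing optimally (`Pandora.fValue_eq_cappedValue`). Hence F-opening box
`i` is optimal whenever stopping is not, and in particular it is at least as good as P-opening it.
-/

noncomputable section

namespace Pandora

section Basic

/-! ### Laws of the prizes -/

theorem Box.isProbabilityMeasure_lawGiven {T : Type*} (b : Box T) {u : Status T} (h : u ≠ .gone) :
    IsProbabilityMeasure (b.lawGiven u) := by
  cases u with
  | closed => exact b.isProbabilityMeasure_prizeLaw
  | partly t => exact b.isProbabilityMeasure_prizeDist t
  | gone => exact (h rfl).elim

theorem Box.integrable_lawGiven {T : Type*} (b : Box T) (u : Status T) :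
    Integrable (fun v : ℝ => v) (b.lawGiven u) := by
  cases u with
  | closed => exact b.integrable_sum
  | partly t => exact b.integrable_prizeDist t
  | gone => exact integrable_zero_measure

theorem Box.integrable_abs_add_const {T : Type*} (b : Box T) {u : Status T} (h : u ≠ .gone)
    (c : ℝ) : Integrable (fun v => |v| + c) (b.lawGiven u) := by
  have := b.isProbabilityMeasure_lawGiven h
  exact (b.integrable_lawGiven u).abs.add (integrable_const c)

theorem Box.hasSum_integral_prizeDist {T : Type*} (b : Box T) {f : ℝ → ℝ}
    (hf : Integrable f b.prizeLaw) :
    HasSum (fun t => (b.typeDist t).toReal * ∫ v, f v ∂b.prizeDist t) (∫ v, f v ∂b.prizeLaw) := by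
  have h := hasSum_integral_measure hf
  simp only [integral_smul_measure, smul_eq_mul] at h
  exact h

theorem excess_antitone {μ : Measure ℝ} [IsProbabilityMeasure μ]
    (hμ : Integrable (fun v : ℝ => v) μ) : Antitone (excess μ) := fun x y hxy =>
  integral_mono (integrable_excess hμ y) (integrable_excess hμ x) fun v =>
    max_le_max (by linarith) le_rfl

theorem excess_condThreshold {T : Type*} (b : Box T) (t : T) :
    excess (b.prizeDist t) (b.condThreshold t) = b.fCost :=
  (b.condThreshold_eq_iff t _).1 rfl

theorem excess_fThreshold {T : Type*} (b : Box T) : excess b.prizeLaw b.fThreshold = b.fCost :=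
  (b.fThreshold_eq_iff _).1 rfl

theorem Box.pExcess_le_pCost {T : Type*} (b : Box T) {x : ℝ} (hx : b.pThreshold ≤ x) :
    b.pExcess x ≤ b.pCost := by
  rw [← (b.pThreshold_eq_iff _).1 rfl]
  refine (b.summable_pTerm _).tsum_le_tsum (fun t => ?_) (b.summable_pTerm _)
  have := b.isProbabilityMeasure_prizeDist t
  have := excess_antitone (b.integrable_prizeDist t) hx
  gcongr

theorem norm_weight_mul_le {T : Type*} (p : PMF T) (t : T) {x y : ℝ} (h : |x| ≤ y) :
    ‖(p t).toReal * x‖ ≤ (p t).toReal * y := by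
  rw [norm_mul, Real.norm_of_nonneg ENNReal.toReal_nonneg]
  exact mul_le_mul_of_nonneg_left h ENNReal.toReal_nonneg

/-- A weighted series of integrals against the type distribution is the integral of the series.
The type space may be uncountable, but the distribution has countable support. -/
theorem hasSum_mul_integral {T α : Type*} {_ : MeasurableSpace α} {μ : Measure α}
    [IsProbabilityMeasure μ] (p : PMF T) (hp : Summable fun t => (p t).toReal) {f : T → α → ℝ}
    (hf : ∀ t, Integrable (f t) μ) {g : T → ℝ} (hg : Summable fun t => (p t).toReal * g t)
    {h : α → ℝ} (hh : Integrable h μ) (hfgh : ∀ t a, |f t a| ≤ g t + h a) :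
    HasSum (fun t => (p t).toReal * ∫ a, f t a ∂μ) (∫ a, ∑' t, (p t).toReal * f t a ∂μ) := by
  have hs : Summable fun t => (p t).toReal * ∫ a, ‖f t a‖ ∂μ := by
    refine Summable.of_nonneg_of_le
      (fun t => mul_nonneg ENNReal.toReal_nonneg (integral_nonneg fun a => norm_nonneg _))
      (fun t => mul_le_mul_of_nonneg_left (?_ : _ ≤ g t + ∫ a, h a ∂μ) ENNReal.toReal_nonneg) ?_
    · have := integral_mono (hf t).norm ((integrable_const (g t)).add hh) (hfgh t)
      rwa [integral_add' (integrable_const _) hh, integral_const, probReal_univ, one_smul] at this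
    · simp only [mul_add]
      exact hg.add (hp.mul_right _)
  have hsum : Summable fun t => (p t).toReal * ∫ a, f t a ∂μ :=
    hs.of_norm_bounded fun t => norm_weight_mul_le p t (norm_integral_le_integral_norm (f t))
  refine (Summable.hasSum_iff hsum).2 ?_
  have : Countable p.support := p.support_countable
  have hzero : ∀ t, t ∉ p.support → (p t).toReal = 0 := fun t ht => by
    rw [PMF.mem_support_iff, not_not] at ht
    rw [ht, ENNReal.toReal_zero]
  have key : ∀ g : T → ℝ,
      ∑' t, (p t).toReal * g t = ∑' t : p.support, (p t).toReal * g t := fun g => by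
    refine (tsum_subtype_eq_of_support_subset fun t ht => ?_).symm
    by_contra hn
    exact ht (by simp only [hzero t hn, zero_mul])
  simp only [key]
  rw [← integral_tsum_of_summable_integral_norm]
  · simp only [integral_const_mul]
  · exact fun t => (hf t).const_mul _
  · simp only [norm_mul, integral_const_mul, Real.norm_eq_abs, ENNReal.abs_toReal]
    exact hs.subtype _

/-! ### Statuses of the boxes -/

variable {ι : Type*} [DecidableEq ι] {Γ : ι → Type*}

/-- The number of times a box with the given status can still be opened. -/
def Status.rank {T : Type*} : Status T → ℕ
  | .closed => 2
  | .partly _ => 1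
  | .gone => 0

theorem sum_update_status [Fintype ι] {M : Type*} [AddCommMonoid M] (g : ∀ i, Status (Γ i) → M)
    (st : ∀ i, Status (Γ i)) (i : ι) (u : Status (Γ i)) :
    ∑ j, g j (Function.update st i u j) = g i u + ∑ j ∈ Finset.univ.erase i, g j (st j) := by
  rw [← Finset.add_sum_erase _ _ (Finset.mem_univ i), Function.update_self]
  congr 1
  refine Finset.sum_congr rfl fun j hj => ?_
  rw [Function.update_of_ne (Finset.ne_of_mem_erase hj)]

/-- Backward induction on the statuses: every opening makes some box less available. -/
theorem status_induction [Fintype ι] {P : (∀ i, Status (Γ i)) → Prop}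
    (h : ∀ st : ∀ i, Status (Γ i),
      (∀ i, st i ≠ .gone → P (Function.update st i .gone)) →
      (∀ i t, st i = .closed → P (Function.update st i (.partly t))) → P st)
    (st : ∀ i, Status (Γ i)) : P st := by
  suffices H : ∀ (n : ℕ) (st : ∀ i, Status (Γ i)), ∑ i, (st i).rank < n → P st from
    H _ st (Nat.lt_succ_self _)
  intro n
  induction n with
  | zero => exact fun _ h0 => absurd h0 (Nat.not_lt_zero _)
  | succ n ih =>
    intro st hst
    rw [Nat.lt_succ_iff] at hst
    have key : ∀ i (u : Status (Γ i)), u.rank < (st i).rank → P (Function.update st i u) := by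
      intro i u hu
      refine ih _ (lt_of_lt_of_le ?_ hst)
      rw [sum_update_status (fun _ w => w.rank), ← Finset.add_sum_erase _ _ (Finset.mem_univ i)]
      exact Nat.add_lt_add_right hu _
    refine h st (fun i hi => key i _ ?_) (fun i t hi => key i _ ?_)
    · cases hu : st i with
      | closed => simp [Status.rank]
      | partly t => simp [Status.rank]
      | gone => exact (hi hu).elim
    · simp [hi, Status.rank]

/-! ### A bound for the profit of admissible policies -/

/-- The expected absolute prize of a box plus the costs that can still be incurred for it. -/
def Box.reserve {T : Type*} (b : Box T) (u : Status T) : ℝ :=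
  ∫ v, |v| ∂b.lawGiven u + match u with
    | .closed => b.fCost + b.pCost
    | .partly _ => b.fCost
    | .gone => 0

theorem Box.reserve_gone {T : Type*} (b : Box T) : b.reserve .gone = 0 := by
  simp [Box.reserve, Box.lawGiven]

theorem Box.integral_abs_add_fCost_le {T : Type*} (b : Box T) {u : Status T} (h : u ≠ .gone) :
    ∫ v, |v| ∂b.lawGiven u + b.fCost ≤ b.reserve u := by
  cases u with
  | closed => simp [Box.reserve, b.pCost_pos.le]
  | partly t => simp [Box.reserve]
  | gone => exact (h rfl).elim

theorem Box.hasSum_reserve {T : Type*} (b : Box T) :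
    HasSum (fun t => (b.typeDist t).toReal * b.reserve (.partly t))
      (b.reserve .closed - b.pCost) := by
  have h := (b.hasSum_integral_prizeDist (f := fun v => |v|) b.integrable_sum.abs).add
    (b.hasSum_typeDist.mul_right b.fCost)
  convert h using 1
  · ext t
    simp [Box.reserve, Box.lawGiven, mul_add]
  · simp only [Box.reserve, Box.lawGiven]
    ring

variable [Fintype ι] (box : ∀ i, Box (Γ i))

/-- A bound for the absolute expected profit of every admissible policy. -/
def envelope (s : State Γ) : ℝ := |s.best| + ∑ i, (box i).reserve (s.status i)

theorem sum_reserve_update (st : ∀ i, Status (Γ i)) (i : ι) (u : Status (Γ i)) :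
    ∑ j, (box j).reserve (Function.update st i u j) =
      (box i).reserve u + (∑ j, (box j).reserve (st j) - (box i).reserve (st i)) := by
  rw [sum_update_status (fun j u => (box j).reserve u), ← Finset.add_sum_erase _
    (fun j => (box j).reserve (st j)) (Finset.mem_univ i), add_sub_cancel_left]

theorem envelope_afterF_le (s : State Γ) (i : ι) (v : ℝ) :
    envelope box (s.afterF i v) ≤ |v| + (envelope box s - (box i).reserve (s.status i)) := by
  have h := sum_reserve_update box s.status i .gone
  rw [Box.reserve_gone] at h
  have h2 : |max s.best v| ≤ |s.best| + |v| :=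
    abs_max_le_max_abs_abs.trans (max_le (by linarith [abs_nonneg v])
      (by linarith [abs_nonneg s.best]))
  simp only [envelope, State.afterF]
  linarith

theorem envelope_afterP (s : State Γ) (i : ι) (t : Γ i) :
    envelope box (s.afterP i t) =
      (box i).reserve (.partly t) + (envelope box s - (box i).reserve (s.status i)) := by
  have h := sum_reserve_update box s.status i (.partly t)
  simp only [envelope, State.afterP]
  linarith

theorem hasSum_envelope_afterP {s : State Γ} {i : ι} (hi : s.status i = .closed) :
    HasSum (fun t => ((box i).typeDist t).toReal * envelope box (s.afterP i t))
      (envelope box s - (box i).pCost) := by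
  have h := (box i).hasSum_reserve.add
    ((box i).hasSum_typeDist.mul_right (envelope box s - (box i).reserve (s.status i)))
  convert h using 1
  · ext t
    rw [envelope_afterP, mul_add]
  · rw [hi]
    ring

theorem abs_neg_add_integral_le {s : State Γ} {i : ι} (hi : s.status i ≠ .gone) {f : ℝ → ℝ}
    (hf : ∀ v, |f v| ≤ envelope box (s.afterF i v)) :
    |-(box i).fCost + ∫ v, f v ∂(box i).lawGiven (s.status i)| ≤ envelope box s := by
  have := (box i).isProbabilityMeasure_lawGiven hi
  have h1 := norm_integral_le_of_norm_le (f := f) ((box i).integrable_abs_add_const hi _)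
    (Eventually.of_forall fun v => (hf v).trans (envelope_afterF_le box s i v))
  rw [integral_add ((box i).integrable_lawGiven _).abs (integrable_const _), integral_const,
    probReal_univ, one_smul, Real.norm_eq_abs] at h1
  have h2 := (box i).integral_abs_add_fCost_le hi
  have h3 := abs_add_le (-(box i).fCost) (∫ v, f v ∂(box i).lawGiven (s.status i))
  rw [abs_neg, abs_of_pos (box i).fCost_pos] at h3
  linarith

theorem summable_afterP {s : State Γ} {i : ι} (hi : s.status i = .closed) {f : Γ i → ℝ}
    (hf : ∀ t, |f t| ≤ envelope box (s.afterP i t)) :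
    Summable fun t => ((box i).typeDist t).toReal * f t :=
  (hasSum_envelope_afterP box hi).summable.of_norm_bounded fun t =>
    norm_weight_mul_le _ t (hf t)

theorem abs_profit_le (π : Policy Γ) (s : State Γ) (h : π.Admissible box s) :
    |π.profit box s| ≤ envelope box s := by
  induction π generalizing s with
  | halt =>
    have : 0 ≤ ∑ i, (box i).reserve (s.status i) := Finset.sum_nonneg fun i _ => by
      have h0 : 0 ≤ ∫ v, |v| ∂(box i).lawGiven (s.status i) :=
        integral_nonneg fun v => abs_nonneg v
      by_cases hi : s.status i = .gone
      · rw [hi, Box.reserve_gone]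
      · linarith [(box i).integral_abs_add_fCost_le hi, (box i).fCost_pos]
    simp only [Policy.profit, envelope]
    linarith
  | fOpen i next ih =>
    obtain ⟨hi, hadm, -⟩ := h
    exact abs_neg_add_integral_le box hi fun v => ih v _ (hadm v)
  | pOpen i next ih =>
    obtain ⟨hi, hadm⟩ := h
    have h1 := tsum_of_norm_bounded (hasSum_envelope_afterP box hi) fun t =>
      norm_weight_mul_le (box i).typeDist t (ih t _ (hadm t))
    have h3 := abs_add_le (-(box i).pCost)
      (∑' t, ((box i).typeDist t).toReal * (next t).profit box (s.afterP i t))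
    rw [abs_neg, abs_of_pos (box i).pCost_pos] at h3
    rw [Real.norm_eq_abs] at h1
    simp only [Policy.profit]
    linarith

end Basic

section Value

/-! ### The value function and the existence of optimal policies -/

variable {ι : Type*} [DecidableEq ι] [Fintype ι] {Γ : ι → Type*} (box : ∀ i, Box (Γ i))

/-- The largest expected profit in a state: the supremum over the admissible policies,
whose profits are bounded by `envelope`. -/
def value (s : State Γ) : ℝ :=
  ⨆ π : {π : Policy Γ // π.Admissible box s}, π.1.profit box s

/-- The expected profit of F-opening box `i` and continuing optimally. -/
def fValue (s : State Γ) (i : ι) : ℝ :=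
  -(box i).fCost + ∫ v, value box (s.afterF i v) ∂(box i).lawGiven (s.status i)

/-- The expected profit of P-opening box `i` and continuing optimally. -/
def pValue (s : State Γ) (i : ι) : ℝ :=
  -(box i).pCost + ∑' t, ((box i).typeDist t).toReal * value box (s.afterP i t)

theorem profit_le_value {π : Policy Γ} {s : State Γ} (h : π.Admissible box s) :
    π.profit box s ≤ value box s := by
  refine le_ciSup (f := fun π : {π : Policy Γ // π.Admissible box s} => π.1.profit box s)
    ⟨envelope box s, ?_⟩ ⟨π, h⟩
  rintro _ ⟨π', rfl⟩
  exact (le_abs_self _).trans (abs_profit_le box _ s π'.2)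

omit [Fintype ι] in
theorem value_le {s : State Γ} {c : ℝ}
    (h : ∀ π : Policy Γ, π.Admissible box s → π.profit box s ≤ c) : value box s ≤ c := by
  have : Nonempty {π : Policy Γ // π.Admissible box s} := ⟨⟨.halt, trivial⟩⟩
  exact ciSup_le fun π => h π.1 π.2

theorem best_le_value (s : State Γ) : s.best ≤ value box s :=
  profit_le_value box (π := .halt) (s := s) trivial

theorem abs_value_le (s : State Γ) : |value box s| ≤ envelope box s := by
  refine abs_le.2 ⟨?_, value_le box fun π h => (le_abs_self _).trans (abs_profit_le box π s h)⟩
  exact (neg_le_of_abs_le (abs_profit_le box .halt s trivial)).trans (best_le_value box s)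

theorem isOptimal_of_value_le {π : Policy Γ} {s : State Γ} (h : π.Admissible box s)
    (hv : value box s ≤ π.profit box s) : π.IsOptimal box s :=
  ⟨h, fun _ h' => (profit_le_value box h').trans hv⟩

/-- The value is monotone in the best prize at hand, and it is attained. Monotonicity makes the
value a measurable function of the observed prizes, so that optimal continuations fit together to
an admissible policy. -/
def IsRegular (st : ∀ i, Status (Γ i)) : Prop :=
  Monotone (fun y => value box ⟨st, y⟩) ∧
    ∀ y, ∃ π : Policy Γ, π.Admissible box ⟨st, y⟩ ∧ π.profit box ⟨st, y⟩ = value box ⟨st, y⟩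

variable {box}

theorem IsRegular.integrable_value {st : ∀ i, Status (Γ i)} (h : IsRegular box st)
    {α : Type*} {_ : MeasurableSpace α} {μ : Measure α} [IsFiniteMeasure μ] {g : α → ℝ}
    (hg : Integrable g μ) : Integrable (fun a => value box ⟨st, g a⟩) μ := by
  refine (hg.abs.add (integrable_const (∑ i, (box i).reserve (st i)))).mono'
    (h.1.measurable.comp_aemeasurable hg.aemeasurable).aestronglyMeasurable
    (Eventually.of_forall fun a => abs_value_le box ⟨st, g a⟩)

theorem IsRegular.integrable_value_afterF {s : State Γ} {i : ι}
    (h : IsRegular box (Function.update s.status i .gone)) (hi : s.status i ≠ .gone) :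
    Integrable (fun v => value box (s.afterF i v)) ((box i).lawGiven (s.status i)) := by
  have := (box i).isProbabilityMeasure_lawGiven hi
  exact h.integrable_value ((integrable_const s.best).sup ((box i).integrable_lawGiven _))

theorem profit_fOpen_le {s : State Γ} {i : ι} {next : ℝ → Policy Γ}
    (h : IsRegular box (Function.update s.status i .gone))
    (hadm : (Policy.fOpen i next).Admissible box s) :
    (Policy.fOpen i next).profit box s ≤ fValue box s i := by
  obtain ⟨hi, hadm, hmeas⟩ := hadm
  refine add_le_add le_rfl (integral_mono ?_ (h.integrable_value_afterF hi) fun v =>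
    profit_le_value box (hadm v))
  exact ((box i).integrable_abs_add_const hi _).mono' hmeas.aestronglyMeasurable
    (Eventually.of_forall fun v =>
      (abs_profit_le box _ _ (hadm v)).trans (envelope_afterF_le box s i v))

theorem profit_pOpen_le {s : State Γ} {i : ι} {next : Γ i → Policy Γ}
    (hadm : (Policy.pOpen i next).Admissible box s) :
    (Policy.pOpen i next).profit box s ≤ pValue box s i := by
  obtain ⟨hi, hadm⟩ := hadm
  refine add_le_add le_rfl (Summable.tsum_le_tsum (fun t => ?_)
    (summable_afterP box hi fun t => abs_profit_le box _ _ (hadm t))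
    (summable_afterP box hi fun t => abs_value_le box _))
  exact mul_le_mul_of_nonneg_left (profit_le_value box (hadm t)) ENNReal.toReal_nonneg

theorem exists_fOpen {s : State Γ} {i : ι}
    (h : IsRegular box (Function.update s.status i .gone)) (hi : s.status i ≠ .gone) :
    ∃ next : ℝ → Policy Γ, (Policy.fOpen i next).Admissible box s ∧
      (Policy.fOpen i next).profit box s = fValue box s i := by
  choose next hadm hval using fun v => h.2 (max s.best v)
  have hval' : (fun v => (next v).profit box (s.afterF i v)) =
      fun v => value box (s.afterF i v) := funext hval
  refine ⟨next, ⟨hi, hadm, ?_⟩, ?_⟩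
  · rw [hval']
    exact (h.integrable_value_afterF hi).aemeasurable
  · simp only [Policy.profit, hval', fValue]

omit [Fintype ι] in
theorem exists_pOpen {s : State Γ} {i : ι}
    (h : ∀ t, IsRegular box (Function.update s.status i (.partly t)))
    (hi : s.status i = .closed) :
    ∃ next : Γ i → Policy Γ, (Policy.pOpen i next).Admissible box s ∧
      (Policy.pOpen i next).profit box s = pValue box s i := by
  choose next hadm hval using fun t => (h t).2 s.best
  have hval' : (fun t => (next t).profit box (s.afterP i t)) =
      fun t => value box (s.afterP i t) := funext hval
  refine ⟨next, ⟨hi, hadm⟩, ?_⟩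
  simp only [Policy.profit, pValue]
  exact congrArg (fun f => -(box i).pCost + ∑' t, ((box i).typeDist t).toReal * f t) hval'

variable (box) in
theorem isRegular (st : ∀ i, Status (Γ i)) : IsRegular box st := by
  induction st using status_induction with
  | h st ihF ihP =>
  constructor
  · intro y y' hy
    refine value_le box fun π hπ => ?_
    cases π with
    | halt => exact hy.trans (best_le_value box ⟨st, y'⟩)
    | fOpen i next =>
      have hi : st i ≠ .gone := hπ.1
      obtain ⟨next', hadm, hval⟩ := exists_fOpen (s := ⟨st, y'⟩) (ihF i hi) hi
      refine (profit_fOpen_le (ihF i hi) hπ).trans (le_trans ?_ (profit_le_value box hadm))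
      rw [hval]
      exact add_le_add le_rfl (integral_mono ((ihF i hi).integrable_value_afterF hi)
        ((ihF i hi).integrable_value_afterF (s := ⟨st, y'⟩) hi)
        fun v => (ihF i hi).1 (max_le_max hy le_rfl))
    | pOpen i next =>
      have hi : st i = .closed := hπ.1
      obtain ⟨next', hadm, hval⟩ := exists_pOpen (s := ⟨st, y'⟩) (fun t => ihP i t hi) hi
      refine (profit_pOpen_le hπ).trans (le_trans ?_ (profit_le_value box hadm))
      rw [hval]
      refine add_le_add le_rfl (Summable.tsum_le_tsum (fun t => ?_)
        (summable_afterP box hi fun t => abs_value_le box _)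
        (summable_afterP (s := ⟨st, y'⟩) box hi fun t => abs_value_le box _))
      exact mul_le_mul_of_nonneg_left ((ihP i t hi).1 hy) ENNReal.toReal_nonneg
  · intro y
    -- One best policy for each first action; unavailable actions are represented by halting.
    have hF : ∀ i, ∃ π : Policy Γ, π.Admissible box ⟨st, y⟩ ∧
        (st i ≠ .gone → fValue box ⟨st, y⟩ i ≤ π.profit box ⟨st, y⟩) := fun i => by
      by_cases hi : st i = .gone
      · exact ⟨.halt, trivial, fun h => (h hi).elim⟩
      · obtain ⟨next, hadm, hval⟩ := exists_fOpen (s := ⟨st, y⟩) (ihF i hi) hi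
        exact ⟨_, hadm, fun _ => hval.ge⟩
    have hP : ∀ i, ∃ π : Policy Γ, π.Admissible box ⟨st, y⟩ ∧
        (st i = .closed → pValue box ⟨st, y⟩ i ≤ π.profit box ⟨st, y⟩) := fun i => by
      by_cases hi : st i = .closed
      · obtain ⟨next, hadm, hval⟩ := exists_pOpen (s := ⟨st, y⟩) (fun t => ihP i t hi) hi
        exact ⟨_, hadm, fun _ => hval.ge⟩
      · exact ⟨.halt, trivial, fun h => (hi h).elim⟩
    choose πF hFadm hFval using hF
    choose πP hPadm hPval using hP
    let cand : Option (ι ⊕ ι) → Policy Γ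
      | none => .halt
      | some (.inl i) => πF i
      | some (.inr i) => πP i
    have hcand : ∀ a, (cand a).Admissible box ⟨st, y⟩
      | none => trivial
      | some (.inl i) => hFadm i
      | some (.inr i) => hPadm i
    obtain ⟨a, ha⟩ := Finite.exists_max fun a => (cand a).profit box ⟨st, y⟩
    refine ⟨cand a, hcand a, le_antisymm (profit_le_value box (hcand a)) ?_⟩
    refine value_le box fun π hπ => ?_
    cases π with
    | halt => exact ha none
    | fOpen i next =>
      exact (profit_fOpen_le (ihF i hπ.1) hπ).trans
        ((hFval i hπ.1).trans (ha (some (.inl i))))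
    | pOpen i next =>
      exact (profit_pOpen_le hπ).trans ((hPval i hπ.1).trans (ha (some (.inr i))))

theorem fValue_le_value {s : State Γ} {i : ι} (hi : s.status i ≠ .gone) :
    fValue box s i ≤ value box s := by
  obtain ⟨next, hadm, hval⟩ := exists_fOpen (isRegular box _) hi
  exact hval ▸ profit_le_value box hadm

theorem pValue_le_value {s : State Γ} {i : ι} (hi : s.status i = .closed) :
    pValue box s i ≤ value box s := by
  obtain ⟨next, hadm, hval⟩ := exists_pOpen (fun _ => isRegular box _) hi
  exact hval ▸ profit_le_value box hadm

theorem integrable_value {st : ∀ i, Status (Γ i)} {α : Type*} {_ : MeasurableSpace α}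
    {μ : Measure α} [IsFiniteMeasure μ] {g : α → ℝ} (hg : Integrable g μ) :
    Integrable (fun a => value box ⟨st, g a⟩) μ :=
  (isRegular box st).integrable_value hg

theorem integrable_pValue {st : ∀ i, Status (Γ i)} {i : ι} (hi : st i = .closed) {α : Type*}
    {_ : MeasurableSpace α} {μ : Measure α} [IsFiniteMeasure μ] {g : α → ℝ}
    (hg : Integrable g μ) : Integrable (fun a => pValue box ⟨st, g a⟩ i) μ := by
  have hmono : Monotone fun y => pValue box ⟨st, y⟩ i := fun y y' hy => by
    refine add_le_add le_rfl (Summable.tsum_le_tsum (fun t => ?_)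
      (summable_afterP (s := ⟨st, y⟩) box hi fun t => abs_value_le box _)
      (summable_afterP (s := ⟨st, y'⟩) box hi fun t => abs_value_le box _))
    exact mul_le_mul_of_nonneg_left ((isRegular box _).1 hy) ENNReal.toReal_nonneg
  refine (hg.abs.add (integrable_const (∑ i, (box i).reserve (st i)))).mono'
    (hmono.measurable.comp_aemeasurable hg.aemeasurable).aestronglyMeasurable
    (Eventually.of_forall fun a => ?_)
  obtain ⟨next, hadm, hval⟩ := exists_pOpen (s := ⟨st, g a⟩) (fun _ => isRegular box _) hi
  exact hval ▸ abs_profit_le box _ _ hadm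

/-- Bellman's inequality: a bound for stopping and for each available opening bounds the value. -/
theorem value_le_of_actions {s : State Γ} {c : ℝ} (h0 : s.best ≤ c)
    (hF : ∀ i, s.status i ≠ .gone → fValue box s i ≤ c)
    (hP : ∀ i, s.status i = .closed → pValue box s i ≤ c) : value box s ≤ c := by
  refine value_le box fun π hπ => ?_
  cases π with
  | halt => exact h0
  | fOpen i next => exact (profit_fOpen_le (isRegular box _) hπ).trans (hF i hπ.1)
  | pOpen i next => exact (profit_pOpen_le hπ).trans (hP i hπ.1)

end Value

section Relaxation

/-! ### Opening thresholds after an opening -/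

section Thresholds

variable {ι : Type*} [DecidableEq ι] {Γ : ι → Type*} {box : ∀ i, Box (Γ i)}
  {s : State Γ} {i : ι} {σ : ℝ}

theorem mem_upperBounds_afterF (v : ℝ) (h : σ ∈ upperBounds (openingThresholds box s)) :
    σ ∈ upperBounds (openingThresholds box (s.afterF i v)) := by
  have key : ∀ {j u}, (s.afterF i v).status j = u → u ≠ .gone → s.status j = u := by
    intro j u hj hu
    by_cases hji : j = i
    · subst hji
      exact (hu (by simpa [State.afterF] using hj.symm)).elim
    · simpa [State.afterF, hji] using hj
  rintro x (⟨j, hj, hx⟩ | ⟨j, t, hj, hx⟩)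
  · exact h (Or.inl ⟨j, key hj (by simp), hx⟩)
  · exact h (Or.inr ⟨j, t, key hj (by simp), hx⟩)

theorem mem_upperBounds_afterP {t : Γ i} (h : σ ∈ upperBounds (openingThresholds box s))
    (ht : (box i).condThreshold t ≤ σ) :
    σ ∈ upperBounds (openingThresholds box (s.afterP i t)) := by
  rintro x (⟨j, hj, hx⟩ | ⟨j, t', hj, hx⟩) <;> by_cases hji : j = i
  · subst hji
    simp [State.afterP] at hj
  · exact h (Or.inl ⟨j, by simpa [State.afterP, hji] using hj, hx⟩)
  · subst hji
    obtain rfl : t = t' := by simpa [State.afterP] using hj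
    exact hx.trans_le ht
  · exact h (Or.inr ⟨j, t', by simpa [State.afterP, hji] using hj, hx⟩)

theorem mem_upperBounds_of_le {ι : Type*} {Γ : ι → Type*} {box : ∀ i, Box (Γ i)} {s : State Γ}
    {σ σ' : ℝ} (h : σ ∈ upperBounds (openingThresholds box s))
    (hσ : σ ≤ σ') : σ' ∈ upperBounds (openingThresholds box s) :=
  upperBounds_mono_mem hσ h

omit [DecidableEq ι] in
/-- If all opening thresholds are at most `σ`, the expected excess over `σ` of the prize of an
available box does not pay for F-opening it. -/
theorem excess_lawGiven_le_fCost (h : σ ∈ upperBounds (openingThresholds box s))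
    (hi : s.status i ≠ .gone) : excess ((box i).lawGiven (s.status i)) σ ≤ (box i).fCost := by
  have := (box i).isProbabilityMeasure_lawGiven hi
  have hmono := excess_antitone ((box i).integrable_lawGiven (s.status i))
  cases hs : s.status i with
  | closed =>
    rw [hs] at hmono
    exact (hmono (h (Or.inl ⟨i, hs, Or.inl rfl⟩))).trans_eq (excess_fThreshold (box i))
  | partly t =>
    rw [hs] at hmono
    exact (hmono (h (Or.inr ⟨i, t, hs, rfl⟩))).trans_eq (excess_condThreshold (box i) t)
  | gone => exact (hi hs).elim

end Thresholds

/-! ### The value is at most the value with a free truncated prize -/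

variable {ι : Type*} [DecidableEq ι] [Fintype ι] {Γ : ι → Type*} (box : ∀ i, Box (Γ i))

/-- The expected value of the state when the prize of box `i` is revealed at no cost, but truncated
at `σ`. It is meaningful only for an available box, since the law of a `gone` box is zero. -/
def cappedValue (s : State Γ) (i : ι) (σ : ℝ) : ℝ :=
  ∫ v, value box ⟨Function.update s.status i .gone, max s.best (min v σ)⟩
    ∂(box i).lawGiven (s.status i)

/-- Stopping is optimal as soon as the best prize at hand is at least every opening threshold. -/
def StopsAboveThresholds (st : ∀ i, Status (Γ i)) : Prop :=
  ∀ y, y ∈ upperBounds (openingThresholds box ⟨st, y⟩) → value box ⟨st, y⟩ ≤ y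

/-- The value is at most the value with one prize revealed at no cost but truncated at a level not
below the opening thresholds. -/
def CappedBound (st : ∀ i, Status (Γ i)) : Prop :=
  ∀ y i σ, st i ≠ .gone → σ ∈ upperBounds (openingThresholds box ⟨st, y⟩) →
    value box ⟨st, y⟩ ≤ cappedValue box ⟨st, y⟩ i σ

variable {box}

theorem integrable_max_min {μ : Measure ℝ} [IsFiniteMeasure μ]
    (hμ : Integrable (fun v : ℝ => v) μ) (y σ : ℝ) :
    Integrable (fun v : ℝ => max y (min v σ)) μ :=
  (integrable_const y).sup (hμ.inf (integrable_const σ))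

/-- Truncating a prize at `σ` loses exactly its expected excess over `σ`, if prizes above `σ` are
collected at once. -/
theorem integral_value_max {μ : Measure ℝ} [IsProbabilityMeasure μ]
    (hμ : Integrable (fun v : ℝ => v) μ) {st : ∀ i, Status (Γ i)} {y σ : ℝ} (hy : y ≤ σ)
    (habove : ∀ z, σ ≤ z → value box ⟨st, z⟩ ≤ z) :
    ∫ v, value box ⟨st, max y v⟩ ∂μ =
      ∫ v, value box ⟨st, max y (min v σ)⟩ ∂μ + excess μ σ := by
  rw [excess, ← integral_add (integrable_value (integrable_max_min hμ y σ))
    (integrable_excess hμ σ)]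
  refine integral_congr_ae (Eventually.of_forall fun v => ?_)
  have hval : ∀ z, σ ≤ z → value box ⟨st, z⟩ = z := fun z hz =>
    le_antisymm (habove z hz) (best_le_value box ⟨st, z⟩)
  dsimp only
  rcases le_total v σ with hv | hv
  · rw [min_eq_left hv, max_eq_right (by linarith : v - σ ≤ 0), add_zero]
  · rw [min_eq_right hv, max_eq_left (by linarith : 0 ≤ v - σ), max_eq_right hy,
      max_eq_right (hy.trans hv), hval σ le_rfl, hval v hv]
    ring

omit [Fintype ι] in
/-- If the level `σ` is at most the best prize at hand, truncation may as well occur there. -/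
theorem cappedValue_max (s : State Γ) (i : ι) (σ : ℝ) :
    cappedValue box s i (max σ s.best) = cappedValue box s i σ := by
  have h : ∀ v, max s.best (min v (max σ s.best)) = max s.best (min v σ) := fun v => by
    grind
  simp only [cappedValue, h]

theorem best_le_cappedValue {s : State Γ} {i : ι} (hi : s.status i ≠ .gone) (σ : ℝ) :
    s.best ≤ cappedValue box s i σ := by
  have := (box i).isProbabilityMeasure_lawGiven hi
  have h := integral_mono (integrable_const s.best)
    (integrable_value (box := box) (st := Function.update s.status i .gone)
      (integrable_max_min ((box i).integrable_lawGiven (s.status i)) s.best σ))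
    fun v => (le_max_left _ _).trans (best_le_value box ⟨_, max s.best (min v σ)⟩)
  rwa [integral_const, probReal_univ, one_smul] at h

/-- F-opening box `i` yields the value with its prize truncated at `σ`, plus the expected excess,
minus the cost. -/
theorem fValue_eq_cappedValue {s : State Γ} {i : ι} {σ : ℝ} (hi : s.status i ≠ .gone)
    (habove : StopsAboveThresholds box (Function.update s.status i .gone))
    (hσ : σ ∈ upperBounds (openingThresholds box s)) (hy : s.best ≤ σ) :
    fValue box s i = cappedValue box s i σ +
      (excess ((box i).lawGiven (s.status i)) σ - (box i).fCost) := by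
  have := (box i).isProbabilityMeasure_lawGiven hi
  have h := integral_value_max (box := box) ((box i).integrable_lawGiven (s.status i)) hy
    (fun z hz => habove z (mem_upperBounds_afterF (i := i) z (mem_upperBounds_of_le hσ hz)))
  simp only [fValue, cappedValue, State.afterF]
  rw [h]
  ring

/-- An F-opening of box `j` commutes with the free truncated prize of box `i`. -/
theorem fValue_le_cappedValue_of_ne {s : State Γ} {i j : ι} {σ : ℝ} (hij : i ≠ j)
    (hi : s.status i ≠ .gone) (hj : s.status j ≠ .gone)
    (h : ∀ v, value box (s.afterF j v) ≤ cappedValue box (s.afterF j v) i σ) :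
    fValue box s j ≤ cappedValue box s i σ := by
  have := (box i).isProbabilityMeasure_lawGiven hi
  have := (box j).isProbabilityMeasure_lawGiven hj
  set μ := (box i).lawGiven (s.status i) with hμ
  set ν := (box j).lawGiven (s.status j) with hν
  have hμint : Integrable (fun v : ℝ => v) μ := (box i).integrable_lawGiven _
  have hνint : Integrable (fun v : ℝ => v) ν := (box j).integrable_lawGiven _
  let st := Function.update (Function.update s.status i .gone) j .gone
  have hcap : ∀ v, cappedValue box (s.afterF j v) i σ =
      ∫ w, value box ⟨st, max (max s.best (min w σ)) v⟩ ∂μ := fun v => by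
    simp only [cappedValue, State.afterF, Function.update_of_ne hij, ← hμ]
    rw [Function.update_comm hij.symm]
    simp only [max_right_comm s.best v]
    rfl
  have hprod : Integrable (Function.uncurry fun v w =>
      value box ⟨st, max (max s.best (min w σ)) v⟩) (ν.prod μ) :=
    integrable_value (((integrable_max_min hμint s.best σ).comp_snd ν).sup (hνint.comp_fst μ))
  have hF : ∀ w, -(box j).fCost + ∫ v, value box ⟨st, max (max s.best (min w σ)) v⟩ ∂ν =
      fValue box ⟨Function.update s.status i .gone, max s.best (min w σ)⟩ j := fun w => by
    simp only [fValue, State.afterF, Function.update_of_ne hij.symm, ← hν]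
    rfl
  have hint : Integrable (fun w =>
      ∫ v, value box ⟨st, max (max s.best (min w σ)) v⟩ ∂ν) μ := hprod.integral_prod_right
  calc fValue box s j
      ≤ -(box j).fCost + ∫ v, ∫ w, value box ⟨st, max (max s.best (min w σ)) v⟩ ∂μ ∂ν :=
        add_le_add le_rfl (integral_mono ((isRegular box _).integrable_value_afterF hj)
          hprod.integral_prod_left fun v => (h v).trans_eq (hcap v))
    _ = ∫ w, (-(box j).fCost + ∫ v, value box ⟨st, max (max s.best (min w σ)) v⟩ ∂ν) ∂μ := by
        rw [integral_integral_swap hprod, integral_add (integrable_const _) hint, integral_const,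
          probReal_univ, one_smul]
    _ ≤ cappedValue box s i σ := by
        refine integral_mono ((integrable_const _).add hint)
          (integrable_value (integrable_max_min hμint s.best σ)) fun w => ?_
        dsimp only
        rw [hF w]
        refine fValue_le_value ?_
        simpa only [Function.update_of_ne hij.symm] using hj

/-- A P-opening of box `j` commutes with the free truncated prize of box `i`. -/
theorem pValue_le_cappedValue_of_ne {s : State Γ} {i j : ι} {σ : ℝ} (hij : i ≠ j)
    (hi : s.status i ≠ .gone) (hj : s.status j = .closed)
    (h : ∀ t, value box (s.afterP j t) ≤ cappedValue box (s.afterP j t) i σ) :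
    pValue box s j ≤ cappedValue box s i σ := by
  have := (box i).isProbabilityMeasure_lawGiven hi
  set μ := (box i).lawGiven (s.status i) with hμ
  have hμint : Integrable (fun v : ℝ => v) μ := (box i).integrable_lawGiven _
  have hg := integrable_max_min hμint s.best σ
  let st := Function.update s.status i .gone
  have hstj : st j = .closed := by simp only [st, Function.update_of_ne hij.symm, hj]
  let r : ℝ → State Γ := fun w => ⟨st, max s.best (min w σ)⟩
  have hcap : ∀ t, cappedValue box (s.afterP j t) i σ =
      ∫ w, value box ((r w).afterP j t) ∂μ := fun t => by
    simp only [cappedValue, State.afterP, Function.update_of_ne hij, ← hμ]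
    rw [Function.update_comm hij.symm]
  have hint : ∀ t, Integrable (fun w => value box ((r w).afterP j t)) μ := fun t =>
    integrable_value (st := Function.update st j (.partly t)) hg
  have henv : Integrable (fun w => envelope box (r w)) μ :=
    hg.abs.add (integrable_const (∑ k, (box k).reserve (st k)))
  have hswap := hasSum_mul_integral (box j).typeDist (box j).hasSum_typeDist.summable hint
    (box j).hasSum_reserve.summable (henv.sub (integrable_const ((box j).reserve .closed)))
    fun t w => by
      have h := abs_value_le box ((r w).afterP j t)
      rw [envelope_afterP] at h
      exact hstj ▸ h
  have hle := (summable_afterP box hj fun t => abs_value_le box _).tsum_le_tsum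
    (fun t => mul_le_mul_of_nonneg_left ((h t).trans_eq (hcap t)) ENNReal.toReal_nonneg)
    hswap.summable
  calc pValue box s j
      ≤ -(box j).pCost + ∫ w, ∑' t, ((box j).typeDist t).toReal *
          value box ((r w).afterP j t) ∂μ :=
        add_le_add le_rfl (hle.trans_eq hswap.tsum_eq)
    _ = ∫ w, pValue box (r w) j ∂μ := by
        have h1 : ∀ w, ∑' t, ((box j).typeDist t).toReal * value box ((r w).afterP j t) =
            pValue box (r w) j + (box j).pCost := fun w => by
          simp only [pValue]
          ring
        simp only [h1]
        rw [integral_add (integrable_pValue hstj hg) (integrable_const _), integral_const,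
          probReal_univ, one_smul]
        ring
    _ ≤ cappedValue box s i σ :=
        integral_mono (integrable_pValue hstj hg) (integrable_value hg) fun w =>
          pValue_le_value hstj

/-- P-opening box `i` is worth at most the free truncated prize of box `i`: a box of high type is
F-opened at once, which adds the expected excess minus the cost, and the expectation of these gains
is `pExcess`, which does not pay for P-opening. -/
theorem pValue_le_cappedValue_self {s : State Γ} {i : ι} {σ : ℝ} (hi : s.status i = .closed)
    (habove : StopsAboveThresholds box (Function.update s.status i .gone))
    (hσ : σ ∈ upperBounds (openingThresholds box s)) (hy : s.best ≤ σ)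
    (h : ∀ t τ, (box i).condThreshold t ≤ τ → σ ≤ τ →
      value box (s.afterP i t) ≤ cappedValue box (s.afterP i t) i τ) :
    pValue box s i ≤ cappedValue box s i σ := by
  let f : ℝ → ℝ := fun v => value box ⟨Function.update s.status i .gone, max s.best (min v σ)⟩
  have hcap : ∀ t τ, cappedValue box (s.afterP i t) i τ =
      ∫ v, value box ⟨Function.update s.status i .gone, max s.best (min v τ)⟩
        ∂(box i).prizeDist t := fun t τ => by
    simp only [cappedValue, State.afterP, Function.update_idem, Function.update_self,
      Box.lawGiven]
  have hle : ∀ t, value box (s.afterP i t) ≤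
      ∫ v, f v ∂(box i).prizeDist t + max 0 (-(box i).fCost + excess ((box i).prizeDist t) σ) := by
    intro t
    rcases le_total ((box i).condThreshold t) σ with ht | ht
    · have h1 := (h t σ ht le_rfl).trans_eq (hcap t σ)
      exact h1.trans (le_add_of_nonneg_right (le_max_left _ _))
    · have := (box i).isProbabilityMeasure_prizeDist t
      have hz : ∀ z, σ ≤ z → value box ⟨Function.update s.status i .gone, z⟩ ≤ z := fun z hz =>
        habove z (mem_upperBounds_afterF (i := i) z (mem_upperBounds_of_le hσ hz))
      have h1 := (h t _ le_rfl ht).trans_eq (hcap t _)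
      have h2 := integral_value_max ((box i).integrable_prizeDist t) hy hz
      have h3 := integral_value_max ((box i).integrable_prizeDist t) (hy.trans ht)
        fun z hz' => hz z (ht.trans hz')
      rw [excess_condThreshold] at h3
      have h4 := le_max_right 0 (-(box i).fCost + excess ((box i).prizeDist t) σ)
      simp only [f]
      linarith
  have hf : Integrable f (box i).prizeLaw :=
    integrable_value (integrable_max_min (μ := (box i).prizeLaw) (box i).integrable_sum s.best σ)
  have hsum := ((box i).hasSum_integral_prizeDist hf).add ((box i).summable_pTerm σ).hasSum
  have h1 : ∑' t, ((box i).typeDist t).toReal * value box (s.afterP i t) ≤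
      ∫ v, f v ∂(box i).prizeLaw + (box i).pExcess σ := by
    refine (Summable.tsum_le_tsum (fun t => ?_)
      (summable_afterP box hi fun t => abs_value_le box _) hsum.summable).trans_eq hsum.tsum_eq
    rw [← mul_add]
    exact mul_le_mul_of_nonneg_left (hle t) ENNReal.toReal_nonneg
  have h2 := (box i).pExcess_le_pCost (hσ (Or.inl ⟨i, hi, Or.inr rfl⟩))
  simp only [pValue, cappedValue, hi, Box.lawGiven]
  simp only [f] at h1
  linarith

/-- The two claims are proved together: the bound uses that prizes above `σ` are collected at once
after box `i` was F-opened, and stopping is optimal by the bound at the best prize at hand. -/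
theorem cappedBound_and_stopsAboveThresholds (st : ∀ i, Status (Γ i)) :
    CappedBound box st ∧ StopsAboveThresholds box st := by
  induction st using status_induction with
  | h st ihF ihP =>
  have hcap : CappedBound box st := by
    intro y i σ hi hσ
    -- Raising the truncation level to the best prize at hand does not change the capped value.
    have hτ := mem_upperBounds_of_le hσ (le_max_left σ y)
    have hy : y ≤ max σ y := le_max_right σ y
    rw [← cappedValue_max]
    dsimp only
    generalize max σ y = τ at hτ hy
    refine value_le_of_actions (best_le_cappedValue hi τ) (fun j hj => ?_) (fun j hj => ?_)
    · by_cases hij : i = j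
      · subst hij
        rw [fValue_eq_cappedValue hi (ihF i hi).2 hτ hy]
        linarith [excess_lawGiven_le_fCost hτ hi]
      · refine fValue_le_cappedValue_of_ne hij hi hj fun v => ?_
        refine (ihF j hj).1 _ i τ ?_ (mem_upperBounds_afterF v hτ)
        rwa [Function.update_of_ne hij]
    · by_cases hij : i = j
      · subst hij
        refine pValue_le_cappedValue_self hj (ihF i hi).2 hτ hy fun t ρ ht hρ => ?_
        refine (ihP i t hj).1 _ i ρ (by simp) ?_
        exact mem_upperBounds_afterP (mem_upperBounds_of_le hτ hρ) ht
      · refine pValue_le_cappedValue_of_ne hij hi hj fun t => ?_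
        have hi' : (Function.update st j (.partly t)) i ≠ .gone := by
          rwa [Function.update_of_ne hij]
        have hj' : (Function.update st j (.partly t)) j ≠ .gone := by simp
        have hjF : st j ≠ .gone := fun h => by simp [h] at hj
        rcases le_total ((box j).condThreshold t) τ with ht | ht
        · exact (ihP j t hj).1 _ i τ hi' (mem_upperBounds_afterP hτ ht)
        -- The bound for `i` at level `τ` is not available if the type of box `j` is high. The
        -- bound for `j` at its own threshold shows that F-opening box `j` is optimal then.
        · let s' : State Γ := State.afterP ⟨st, y⟩ j t
          have hub := mem_upperBounds_afterP (t := t) (mem_upperBounds_of_le hτ ht) le_rfl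
          have hidem : Function.update s'.status j .gone = Function.update st j .gone :=
            Function.update_idem _ _ _
          have h1 : value box s' ≤ cappedValue box s' j ((box j).condThreshold t) :=
            (ihP j t hj).1 _ j _ hj' hub
          have h2 := fValue_eq_cappedValue (s := s') hj' (hidem ▸ (ihF j hjF).2) hub
            (hy.trans ht)
          have h3 : excess ((box j).lawGiven (s'.status j)) ((box j).condThreshold t) =
              (box j).fCost := by
            simp only [s', State.afterP, Function.update_self, Box.lawGiven, excess_condThreshold]
          have h4 : fValue box s' j ≤ cappedValue box s' i τ := by
            refine fValue_le_cappedValue_of_ne hij hi' hj' fun v => ?_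
            have h5 := (ihF j hjF).1 (max y v) i τ (by rwa [Function.update_of_ne hij])
              (mem_upperBounds_afterF v hτ)
            rw [← hidem] at h5
            exact h5
          exact h1.trans (by linarith)
  refine ⟨hcap, fun y hy => ?_⟩
  by_cases hgone : ∀ i, st i = .gone
  · exact value_le_of_actions le_rfl (fun i hi => (hi (hgone i)).elim) fun i hi => by
      simp [hgone i] at hi
  · push Not at hgone
    obtain ⟨i, hi⟩ := hgone
    have := (box i).isProbabilityMeasure_lawGiven hi
    have h := hcap y i y hi hy
    -- A prize truncated at the best prize at hand never improves on it.
    simp only [cappedValue, max_eq_left (min_le_right _ y), integral_const, probReal_univ,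
      one_smul] at h
    exact h.trans ((ihF i hi).2 y (mem_upperBounds_afterF (i := i) y hy))

/-! ### Optimal openings -/

theorem value_le_best {s : State Γ} (h : s.best ∈ upperBounds (openingThresholds box s)) :
    value box s ≤ s.best :=
  (cappedBound_and_stopsAboveThresholds s.status).2 s.best h

/-- F-opening an available box whose opening threshold is the largest one, and at least the best
prize at hand, is optimal: the excess lost by truncating its prize there is exactly the cost. -/
theorem exists_fOpen_isOptimal {s : State Γ} {i : ι} {σ : ℝ} (hi : s.status i ≠ .gone)
    (hexc : excess ((box i).lawGiven (s.status i)) σ = (box i).fCost)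
    (hσ : σ ∈ upperBounds (openingThresholds box s)) (hy : s.best ≤ σ) :
    ∃ next : ℝ → Policy Γ, (Policy.fOpen i next).IsOptimal box s := by
  obtain ⟨next, hadm, hval⟩ := exists_fOpen (isRegular box _) hi
  refine ⟨next, isOptimal_of_value_le box hadm ?_⟩
  rw [hval, fValue_eq_cappedValue hi (cappedBound_and_stopsAboveThresholds _).2 hσ hy, hexc,
    sub_self, add_zero]
  exact (cappedBound_and_stopsAboveThresholds s.status).1 s.best i σ hi hσ

theorem best_lt_of_not_isOptimal_halt {s : State Γ} {σ : ℝ}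
    (hσ : σ ∈ upperBounds (openingThresholds box s)) (h : ¬ Policy.halt.IsOptimal box s) :
    s.best < σ := by
  by_contra! hle
  exact h (isOptimal_of_value_le box trivial (value_le_best (mem_upperBounds_of_le hσ hle)))

end Relaxation

end Pandora

end

theorem mainTheorem2 {ι : Type*} [Fintype ι] [DecidableEq ι] {Γ : ι → Type*}
    (box : ∀ i, Pandora.Box (Γ i)) (s : Pandora.State Γ) :
    -- the largest threshold is that of a partially opened box
    (∀ (k : ι) (t : Γ k), s.status k = .partly t →
      IsGreatest (Pandora.openingThresholds box s) ((box k).condThreshold t) →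
      ¬ Pandora.Policy.halt.IsOptimal box s →
        ∃ next : ℝ → Pandora.Policy Γ, (Pandora.Policy.fOpen k next).IsOptimal box s) ∧
    -- the largest threshold is the F-threshold of a closed box
    (∀ i : ι, s.status i = .closed → (box i).pThreshold < (box i).fThreshold →
      IsGreatest (Pandora.openingThresholds box s) (box i).fThreshold →
      ¬ Pandora.Policy.halt.IsOptimal box s →
        ∃ next : ℝ → Pandora.Policy Γ, (Pandora.Policy.fOpen i next).IsOptimal box s) ∧
    -- P-opening such a closed box is dominated, whether or not stopping is optimal
    (∀ i : ι, s.status i = .closed → (box i).pThreshold < (box i).fThreshold →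
      IsGreatest (Pandora.openingThresholds box s) (box i).fThreshold →
      ∀ next : Γ i → Pandora.Policy Γ, (Pandora.Policy.pOpen i next).Admissible box s →
        (Pandora.Policy.pOpen i next).profit box s ≤ Pandora.Policy.halt.profit box s ∨
        ∃ next' : ℝ → Pandora.Policy Γ, (Pandora.Policy.fOpen i next').Admissible box s ∧
          (Pandora.Policy.pOpen i next).profit box s ≤
            (Pandora.Policy.fOpen i next').profit box s) := by
  have closedCase : ∀ i : ι, s.status i = .closed →
      IsGreatest (Pandora.openingThresholds box s) (box i).fThreshold →
      ¬ Pandora.Policy.halt.IsOptimal box s →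
        ∃ next : ℝ → Pandora.Policy Γ, (Pandora.Policy.fOpen i next).IsOptimal box s := by
    intro i hi hmax hhalt
    refine Pandora.exists_fOpen_isOptimal (by simp [hi]) ?_ hmax.2
      (Pandora.best_lt_of_not_isOptimal_halt hmax.2 hhalt).le
    rw [hi]
    exact Pandora.excess_fThreshold (box i)
  refine ⟨fun k t hk hmax hhalt => ?_, fun i hi _ => closedCase i hi,
    fun i hi _ hmax next hadm => ?_⟩
  · refine Pandora.exists_fOpen_isOptimal (by simp [hk]) ?_ hmax.2
      (Pandora.best_lt_of_not_isOptimal_halt hmax.2 hhalt).le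
    rw [hk]
    exact Pandora.excess_condThreshold (box k) t
  · by_cases hhalt : Pandora.Policy.halt.IsOptimal box s
    · exact Or.inl (hhalt.2 _ hadm)
    · obtain ⟨next', hopt⟩ := closedCase i hi hmax hhalt
      exact Or.inr ⟨next', hopt.1, hopt.2 _ hadm⟩
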